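/- For $n\ge 0$ let $\mathfrak C_n$ be the complex $*$-algebra generated by self-adjoint elements $\chi_1,\dots,\chi_n$ with $\chi_j^2=1$ and $\chi_j\chi_k=-\chi_k\chi_j$ for $j\ne k$; it has the basis $\chi^S=\chi_{k_1}\cdots\chi_{k_q}$, where $S=\{k_1<\dots<k_q\}\subseteq[n]$, and the adjoint $*$ conjugates coefficients and reverses words. For a linear subspace $G\subseteq\mathfrak C_n$, call $a\in\mathfrak C_n$ a $G$-sum of squares if $a=\sum_{i=1}^m g_i^*g_i$ for some $m$ and $g_1,\dots,g_m\in G$. A $G$-pseudoexpectation is a linear functional $\widetilde{\mathbb E}:\mathfrak C_n\to\mathbb C$ with $\widetilde{\mathbb E}[a^*]=\overline{\widetilde{\mathbb E}[a]}$, $\widetilde{\mathbb E}[1]=1$ and $\widetilde{\mathbb E}[a]\ge 0$ for every $G$-sum of squares $a$. For self-adjoint $h$ let $\mathrm{val}_G(h)$ be the supremum of $\widetilde{\mathbb E}[h]$ over all $G$-pseudoexpectations. Put - $\mathrm{Opt}(h)=\mathrm{val}_{\mathfrak C_n}(h)$, the supremum of $\mathbb E[h]$ over all states; - $\mathrm{SOS}_{2k}(h)=\mathrm{val}_G(h)$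 with $G=\mathrm{span}\{\chi^S:|S|\le k\}$; a $G$-sum of squares for this $G$ is called degree-$2k$ SOS; - $\mathrm{SOS}_{4,2}(h)=\mathrm{val}_G(h)$ with $G=\mathrm{span}\big(\{\chi^S:|S|\le 2\}\cup\{\tau_1,\dots,\tau_n\}\big)$, where $\tau_i=\frac{\sqrt n}{4}\,(h\chi_i-\chi_i h)$. Let $h\sim\mathrm{SYK}_4(n)$, that is, $h=\binom n4^{-1/2}\sum_{S\subseteq[n],\,|S|=4}J_S\,\chi^S$ with independent standard real Gaussians $J_S$ (and $h=0$ if $n<4$). **Theorem.** For every $n$ and every value of the coefficients $J_S\in\mathbb R$, $$\mathrm{Opt}(h)\le \mathrm{SOS}_6(h)\le \mathrm{SOS}_{4,2}(h).$$ Moreover, there is a universal constant $C>0$ such that, with probability tending to $1$ as $n\to\infty$, all of the following hold: $\mathrm{SOS}_{4,2}(h)\le C\sqrt n$, $\mathrm{SOS}_6(h)\le C\sqrt n$, and $C\sqrt n-h$ is degree-$6$ SOS. In particular, degree-$6$ SOS certifies the upper bound $\mathrm{Opt}(h)\le C\sqrt n$ with high probability. -/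

import Mathlib

open MeasureTheory ProbabilityTheory Filter Topology
open scoped symmDiff

/-- The complex Clifford algebra on `n` self-adjoint generators `χ_1, …, χ_n` with `χ_j² = 1` and
`χ_j χ_k = -χ_k χ_j` for `j ≠ k`.  An element is given by its coefficients in the basis of ordered
monomials `χ^S = χ_{k_1} ⋯ χ_{k_q}`, `S = {k_1 < ⋯ < k_q}`. -/
def MajoranaAlgebra (n : ℕ) : Type := Finset (Fin n) → ℂ

namespace MajoranaAlgebra

variable {n : ℕ}

noncomputable instance : AddCommGroup (MajoranaAlgebra n) :=
  inferInstanceAs (AddCommGroup (Finset (Fin n) → ℂ))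

noncomputable instance : Module ℂ (MajoranaAlgebra n) :=
  inferInstanceAs (Module ℂ (Finset (Fin n) → ℂ))

/-- The sign in `χ^S χ^T = crossSign S T • χ^(S ∆ T)`: one factor `-1` for every pair
`s ∈ S`, `t ∈ T` with `t < s`. -/
def crossSign (S T : Finset (Fin n)) : ℂ := ∏ s ∈ S, ∏ t ∈ T, if t < s then -1 else 1

theorem prod_symmDiff_of_sq {F : Fin n → ℂ} (hF : ∀ i, F i * F i = 1) (S T : Finset (Fin n)) :
    ∏ i ∈ S ∆ T, F i = (∏ i ∈ S, F i) * ∏ i ∈ T, F i := by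
  have h1 : ∀ A : Finset (Fin n), (∏ i ∈ A, F i) = ∏ i, if i ∈ A then F i else 1 := by
    intro A; simp
  rw [h1, h1 S, h1 T, ← Finset.prod_mul_distrib]
  refine Finset.prod_congr rfl fun i _ => ?_
  by_cases hS : i ∈ S <;> by_cases hT : i ∈ T <;> simp [Finset.mem_symmDiff, hS, hT, hF]

theorem prod_mul_self_of_sq {F : Fin n → ℂ} (hF : ∀ i, F i * F i = 1) (S : Finset (Fin n)) :
    (∏ i ∈ S, F i) * ∏ i ∈ S, F i = 1 := by
  rw [← Finset.prod_mul_distrib]; simp [hF]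

theorem crossSign_symmDiff_left (S S' T : Finset (Fin n)) :
    crossSign (S ∆ S') T = crossSign S T * crossSign S' T := by
  refine prod_symmDiff_of_sq (fun i => prod_mul_self_of_sq (fun j => ?_) T) S S'
  split_ifs <;> simp

theorem crossSign_symmDiff_right (S T T' : Finset (Fin n)) :
    crossSign S (T ∆ T') = crossSign S T * crossSign S T' := by
  unfold crossSign
  rw [← Finset.prod_mul_distrib]
  refine Finset.prod_congr rfl fun s _ => prod_symmDiff_of_sq (fun j => ?_) T T'
  split_ifs <;> simp

theorem crossSign_mul_self (S T : Finset (Fin n)) : crossSign S T * crossSign S T = 1 := by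
  refine prod_mul_self_of_sq (fun i => prod_mul_self_of_sq (fun j => ?_) T) S
  split_ifs <;> simp

@[simp] theorem crossSign_empty_left (T : Finset (Fin n)) : crossSign ∅ T = 1 := by
  simp [crossSign]

@[simp] theorem crossSign_empty_right (S : Finset (Fin n)) : crossSign S ∅ = 1 := by
  simp [crossSign]

theorem conj_crossSign (S T : Finset (Fin n)) : star (crossSign S T) = crossSign S T := by
  simp only [crossSign, Complex.star_def, map_prod]
  refine Finset.prod_congr rfl fun s _ => Finset.prod_congr rfl fun t _ => ?_
  split_ifs <;> simp

/-- Reversing the ordered monomial `χ^S` produces the sign `(-1)^(|S| choose 2)`. -/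
theorem crossSign_self (S : Finset (Fin n)) : crossSign S S = (-1) ^ (S.card.choose 2) := by
  induction S using Finset.induction_on_min with
  | empty => simp
  | insert a S ha ih =>
    have haS : a ∉ S := fun h => lt_irrefl _ (ha a h)
    have h1 : insert a S = {a} ∆ S := by
      ext x; simp only [Finset.mem_insert, Finset.mem_symmDiff, Finset.mem_singleton]
      by_cases hx : x = a
      · subst hx; simp [haS]
      · simp [hx]
    have h2 : crossSign {a} S = 1 := by
      simp only [crossSign, Finset.prod_singleton]
      exact Finset.prod_eq_one fun t ht => by simp [(ha t ht).le]
    have h3 : crossSign S {a} = (-1) ^ S.card := by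
      simp only [crossSign, Finset.prod_singleton]
      rw [Finset.prod_congr rfl (fun s hs => if_pos (ha s hs))]; simp
    have h4 : crossSign {a} ({a} : Finset (Fin n)) = 1 := by simp [crossSign]
    rw [Finset.card_insert_of_notMem haS, h1, crossSign_symmDiff_left, crossSign_symmDiff_right,
      crossSign_symmDiff_right, h2, h3, h4, ih, Nat.choose_succ_succ' S.card 1]
    simp [pow_add]

/-- The ordered monomial `χ^S`. -/
noncomputable def monomial (S : Finset (Fin n)) : MajoranaAlgebra n :=
  (Pi.single S 1 : Finset (Fin n) → ℂ)

noncomputable instance : One (MajoranaAlgebra n) := ⟨monomial ∅⟩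

noncomputable instance : Mul (MajoranaAlgebra n) :=
  ⟨fun f g U => ∑ S, crossSign S (S ∆ U) * f S * g (S ∆ U)⟩

theorem mul_apply (f g : MajoranaAlgebra n) (U : Finset (Fin n)) :
    (f * g) U = ∑ S, crossSign S (S ∆ U) * f S * g (S ∆ U) := rfl

theorem add_apply (f g : MajoranaAlgebra n) (U : Finset (Fin n)) : (f + g) U = f U + g U := rfl

theorem smul_apply (c : ℂ) (f : MajoranaAlgebra n) (U : Finset (Fin n)) :
    (c • f) U = c * f U := rfl

theorem zero_apply (U : Finset (Fin n)) : (0 : MajoranaAlgebra n) U = 0 := rfl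

theorem monomial_apply (S U : Finset (Fin n)) :
    (monomial S : MajoranaAlgebra n) U = if U = S then 1 else 0 := by
  unfold monomial; exact Pi.single_apply S (1 : ℂ) U

theorem one_apply (U : Finset (Fin n)) :
    (1 : MajoranaAlgebra n) U = if U = ∅ then 1 else 0 := monomial_apply ∅ U

@[ext] theorem ext {f g : MajoranaAlgebra n} (h : ∀ U, f U = g U) : f = g := funext h

noncomputable instance : Ring (MajoranaAlgebra n) where
  __ := (inferInstance : AddCommGroup (MajoranaAlgebra n))
  left_distrib f g h := by
    ext U; simp only [mul_apply, add_apply, mul_add, Finset.sum_add_distrib]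
  right_distrib f g h := by
    ext U; simp only [mul_apply, add_apply, mul_add, add_mul, Finset.sum_add_distrib]
  zero_mul f := by ext U; simp [mul_apply, zero_apply]
  mul_zero f := by ext U; simp [mul_apply, zero_apply]
  one_mul f := by
    ext U; simp only [mul_apply, one_apply]
    rw [Finset.sum_eq_single ∅]
    · rw [← Finset.bot_eq_empty, bot_symmDiff, Finset.bot_eq_empty]; simp
    · intro S _ hS; simp [hS]
    · simp
  mul_one f := by
    ext U
    simp only [mul_apply, one_apply]
    rw [Finset.sum_eq_single U]
    · simp
    · intro S _ hS
      rw [if_neg (by simpa [symmDiff_eq_bot] using hS)]; simp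
    · simp
  mul_assoc f g h := by
    ext U
    simp only [mul_apply, Finset.mul_sum, Finset.sum_mul]
    rw [Finset.sum_comm]
    refine Finset.sum_congr rfl fun R _ => ?_
    refine Fintype.sum_equiv (symmDiff_left_involutive R |>.toPerm) _ _ fun S => ?_
    have e1 : (S ∆ R) ∆ (R ∆ U) = S ∆ U := by rw [symmDiff_assoc, symmDiff_symmDiff_cancel_left]
    simp only [Function.Involutive.coe_toPerm, e1]
    have e2 : crossSign S (S ∆ U) = crossSign R (S ∆ U) * crossSign (S ∆ R) (S ∆ U) := by
      rw [crossSign_symmDiff_left, mul_left_comm, crossSign_mul_self, mul_one]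
    have e3 : crossSign R (R ∆ U) = crossSign R (R ∆ S) * crossSign R (S ∆ U) := by
      rw [← crossSign_symmDiff_right, symmDiff_assoc, symmDiff_symmDiff_cancel_left]
    rw [e2, e3, symmDiff_comm S R]; ring

noncomputable instance : Algebra ℂ (MajoranaAlgebra n) :=
  Algebra.ofModule
    (fun c f g => by
      ext U; simp only [mul_apply, smul_apply, Finset.mul_sum]
      exact Finset.sum_congr rfl fun _ _ => by ring)
    (fun c f g => by
      ext U; simp only [mul_apply, smul_apply, Finset.mul_sum]
      exact Finset.sum_congr rfl fun _ _ => by ring)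

/-- The adjoint: it conjugates coefficients and reverses words, and so multiplies the coefficient
of `χ^S` by `(-1)^(|S| choose 2)`. -/
noncomputable instance : Star (MajoranaAlgebra n) :=
  ⟨fun f S => (-1) ^ (S.card.choose 2) * star (f S)⟩

theorem star_apply (f : MajoranaAlgebra n) (S : Finset (Fin n)) :
    (star f) S = (-1) ^ (S.card.choose 2) * star (f S) := rfl

noncomputable instance : StarRing (MajoranaAlgebra n) where
  star_involutive f := by
    ext S
    rw [star_apply, star_apply, ← crossSign_self, star_mul', conj_crossSign, star_star,
      ← mul_assoc, crossSign_mul_self, one_mul]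
  star_add f g := by ext S; simp only [star_apply, add_apply, star_add, mul_add]
  star_mul f g := by
    ext U
    simp only [star_apply, mul_apply, star_sum, star_mul', conj_crossSign, Finset.mul_sum,
      ← crossSign_self]
    refine Fintype.sum_equiv (symmDiff_left_involutive U |>.toPerm) _ _ fun S => ?_
    have e1 : (S ∆ U) ∆ U = S := by rw [symmDiff_assoc]; simp
    have e2 : crossSign U U = crossSign S S * crossSign S (S ∆ U) *
        (crossSign (S ∆ U) S * crossSign (S ∆ U) (S ∆ U)) := by
      rw [← crossSign_symmDiff_right, ← crossSign_symmDiff_right, ← crossSign_symmDiff_left,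
        symmDiff_symmDiff_cancel_left]
    simp only [Function.Involutive.coe_toPerm, e1]
    rw [e2]
    linear_combination (crossSign S S * crossSign (S ∆ U) S * crossSign (S ∆ U) (S ∆ U) *
      star (f S) * star (g (S ∆ U))) * crossSign_mul_self S (S ∆ U)

instance : StarModule ℂ (MajoranaAlgebra n) where
  star_smul c f := by
    ext S; simp only [star_apply, smul_apply, star_mul']; ring

/-- The generator `χ_i`. -/
noncomputable def chi (i : Fin n) : MajoranaAlgebra n := monomial {i}

theorem monomial_mul_monomial (S T : Finset (Fin n)) :
    (monomial S * monomial T : MajoranaAlgebra n) = crossSign S T • monomial (S ∆ T) := by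
  ext U
  rw [mul_apply, smul_apply, Finset.sum_eq_single S]
  · simp only [monomial_apply]
    by_cases h : U = S ∆ T
    · subst h; simp
    · have : S ∆ U ≠ T := fun h' => h (by rw [← h', symmDiff_symmDiff_cancel_left])
      simp [h, this]
  · intro R _ hR; simp [monomial_apply, hR]
  · simp

theorem chi_mul_self (i : Fin n) : (chi i * chi i : MajoranaAlgebra n) = 1 := by
  unfold chi; rw [monomial_mul_monomial]; simp [crossSign]; rfl

theorem chi_anticomm {i j : Fin n} (h : i ≠ j) :
    (chi i * chi j : MajoranaAlgebra n) = -(chi j * chi i) := by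
  unfold chi
  rw [monomial_mul_monomial, monomial_mul_monomial, symmDiff_comm ({j} : Finset (Fin n)), ← neg_smul]
  congr 1
  rcases lt_or_gt_of_ne h with h | h <;> simp [crossSign, h, h.le]

theorem star_chi (i : Fin n) : star (chi i : MajoranaAlgebra n) = chi i := by
  ext S
  rw [star_apply, chi, monomial_apply]
  split_ifs with h <;> simp [h]

/-- `χ^S` is the increasing product of the generators `χ_i`, `i ∈ S`. -/
theorem monomial_eq_prod (S : Finset (Fin n)) :
    (monomial S : MajoranaAlgebra n) = ((S.sort (· ≤ ·)).map chi).prod := by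
  induction S using Finset.induction_on_min with
  | empty => simp; rfl
  | insert a S ha ih =>
    have haS : a ∉ S := fun h => lt_irrefl _ (ha a h)
    have h1 : {a} ∆ S = insert a S := by
      ext x; simp only [Finset.mem_insert, Finset.mem_symmDiff, Finset.mem_singleton]
      by_cases hx : x = a
      · subst hx; simp [haS]
      · simp [hx]
    have h2 : crossSign {a} S = 1 := by
      simp only [crossSign, Finset.prod_singleton]
      exact Finset.prod_eq_one fun t ht => by simp [(ha t ht).le]
    rw [Finset.sort_insert (· ≤ ·) (fun b hb => (ha b hb).le) haS, List.map_cons, List.prod_cons, ← ih,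
      chi, monomial_mul_monomial, h1, h2, one_smul]

/-- Polynomials of degree at most `k` in the generators. -/
noncomputable def degLE (n k : ℕ) : Submodule ℂ (MajoranaAlgebra n) :=
  Submodule.span ℂ {a | ∃ S : Finset (Fin n), S.card ≤ k ∧ a = monomial S}

/-- `a = g_1* g_1 + ⋯ + g_m* g_m` with all `g_i` in the space `G`.  For `G = degLE n k` this says
that `a` is a degree-`2k` sum of Hermitian squares. -/
def IsSOS (G : Submodule ℂ (MajoranaAlgebra n)) (a : MajoranaAlgebra n) : Prop :=
  ∃ (m : ℕ) (g : Fin m → MajoranaAlgebra n), (∀ i, g i ∈ G) ∧ a = ∑ i, star (g i) * g i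

/-- Pseudoexpectations with respect to `G`: normalized Hermitian linear functionals that are
nonnegative on all sums of Hermitian squares of elements of `G`. -/
structure IsPseudoexpectation (G : Submodule ℂ (MajoranaAlgebra n))
    (E : MajoranaAlgebra n →ₗ[ℂ] ℂ) : Prop where
  map_star : ∀ a, E (star a) = star (E a)
  map_one : E 1 = 1
  nonneg : ∀ a, IsSOS G a → 0 ≤ (E a).re

/-- The supremum of `E[h]` over the pseudoexpectations `E` with respect to `G` (for self-adjoint
`h`, `E[h]` is real). -/
noncomputable def relaxationValue (G : Submodule ℂ (MajoranaAlgebra n)) (h : MajoranaAlgebra n) :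
    EReal :=
  sSup {x | ∃ E : MajoranaAlgebra n →ₗ[ℂ] ℂ, IsPseudoexpectation G E ∧ x = (((E h).re : ℝ) : EReal)}

/-- `Opt(h)`: the supremum of `E[h]` over all states `E`, the normalized Hermitian functionals that
are nonnegative on every `g* g`. -/
noncomputable def opt (h : MajoranaAlgebra n) : EReal := relaxationValue ⊤ h

/-- `SOS_{2k}(h)`, the value of the degree-`2k` sum-of-squares relaxation. -/
noncomputable def sosValue (k : ℕ) (h : MajoranaAlgebra n) : EReal :=
  relaxationValue (degLE n k) h

/-- The cubic elements `τ_i = (√n / 4) [h, χ_i]` attached to a quartic `h`. -/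
noncomputable def tau (h : MajoranaAlgebra n) (i : Fin n) : MajoranaAlgebra n :=
  ((Real.sqrt n / 4 : ℝ) : ℂ) • (h * chi i - chi i * h)

/-- The space of polynomials of degree at most `2` in `χ` plus linear combinations of the `τ_i`. -/
noncomputable def deg42 (h : MajoranaAlgebra n) : Submodule ℂ (MajoranaAlgebra n) :=
  degLE n 2 ⊔ Submodule.span ℂ (Set.range (tau h))

/-- `SOS_{4,2}(h)`. -/
noncomputable def sos42Value (h : MajoranaAlgebra n) : EReal := relaxationValue (deg42 h) h

/-- The quartic Hamiltonian `h = (n choose 4)^(-1/2) ∑_{|S| = 4} J_S χ^S`. -/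
noncomputable def sykHamiltonian (n : ℕ) (J : {S : Finset (Fin n) // S.card = 4} → ℝ) :
    MajoranaAlgebra n :=
  ((1 / Real.sqrt (n.choose 4) : ℝ) : ℂ) • ∑ S, (J S : ℂ) • monomial S.1

/-- The law of the coefficients `J_S` of `SYK_4(n)`: independent standard Gaussians. -/
noncomputable def sykMeasure (n : ℕ) : Measure ({S : Finset (Fin n) // S.card = 4} → ℝ) :=
  Measure.pi fun _ => gaussianReal 0 1

end MajoranaAlgebra

namespace MajoranaAlgebra

variable {n : ℕ}

/-! ### Cones of sums of squares and monotonicity of the relaxations -/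

/-! Write `h_U` for `part c U`, so that `h = h_∅`. Since `[h, χ_i] = 2 h_i χ_i`, each `τ_i` is
`(√n/2) h_i χ_i`, a cubic. Hence `deg42 h ≤ degLE n 3`, and the comparison of relaxations is
monotonicity in the space of squares.

For the upper bound, anticommutation of `χ_i` with `h_i` gives `|χ_i + τ_i|² = 1 - √n h_i + (n/4)
h_i²`. Summing over `i` bounds `4√n h` by `n + (n/4) ∑ h_i²`, modulo squares. The identity `∑ h_i² =
2 ∑_P h_P² - 8 ∑ c_S²`, with `P` ranging over pairs, replaces the squares of cubics by squares of
quadratics (`four_sqrt_smul_part_empty`). Indeed `h_P²` is the square of `h_P χ^P = ∑_Q A_PQ χ^Q`,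
where `A` is `pairMatrix c`, so `∑_P h_P² ≤ ‖A‖² (n choose 2)` modulo squares of quadratics. This
gives the deterministic certificate `isSOS_deg42_of_mulVec_le`.

It remains to see that `‖A‖² (n choose 2)` is bounded with high probability. For unnormalized
Gaussian coefficients, a net argument with sub-Gaussian tails gives `‖A‖² = O(n choose 2)`
(`sykMeasure_not_mulVec_le`). The normalization divides this by `n choose 4`, which is of order `(n
choose 2)²`. -/

theorem isSOS_zero (G : Submodule ℂ (MajoranaAlgebra n)) : IsSOS G 0 :=
  ⟨0, Fin.elim0, fun i => i.elim0, by simp⟩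

theorem isSOS_star_mul_self {G : Submodule ℂ (MajoranaAlgebra n)} {g : MajoranaAlgebra n}
    (hg : g ∈ G) : IsSOS G (star g * g) :=
  ⟨1, fun _ => g, fun _ => hg, by simp⟩

theorem IsSOS.add {G : Submodule ℂ (MajoranaAlgebra n)} {a b : MajoranaAlgebra n}
    (ha : IsSOS G a) (hb : IsSOS G b) : IsSOS G (a + b) := by
  obtain ⟨m, f, hf, rfl⟩ := ha
  obtain ⟨k, g, hg, rfl⟩ := hb
  refine ⟨m + k, Fin.append f g, fun i => ?_, ?_⟩
  · refine Fin.addCases (fun i => ?_) (fun i => ?_) i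
    · simpa using hf i
    · simpa using hg i
  · simp [Fin.sum_univ_add]

theorem IsSOS.sum {G : Submodule ℂ (MajoranaAlgebra n)} {ι : Type*} (s : Finset ι)
    {a : ι → MajoranaAlgebra n} (ha : ∀ i ∈ s, IsSOS G (a i)) : IsSOS G (∑ i ∈ s, a i) :=
  Finset.sum_induction a (IsSOS G) (fun _ _ => IsSOS.add) (isSOS_zero G) ha

theorem IsSOS.smul {G : Submodule ℂ (MajoranaAlgebra n)} {a : MajoranaAlgebra n}
    (ha : IsSOS G a) {r : ℝ} (hr : 0 ≤ r) : IsSOS G ((r : ℂ) • a) := by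
  obtain ⟨m, f, hf, rfl⟩ := ha
  refine ⟨m, fun i => ((√r : ℝ) : ℂ) • f i, fun i => G.smul_mem _ (hf i), ?_⟩
  rw [Finset.smul_sum]
  refine Finset.sum_congr rfl fun i _ => ?_
  rw [star_smul, smul_mul_smul_comm, Complex.star_def, Complex.conj_ofReal, ← Complex.ofReal_mul,
    Real.mul_self_sqrt hr]

theorem IsSOS.mono {G G' : Submodule ℂ (MajoranaAlgebra n)} (hG : G ≤ G') {a : MajoranaAlgebra n}
    (ha : IsSOS G a) : IsSOS G' a := by
  obtain ⟨m, f, hf, rfl⟩ := ha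
  exact ⟨m, f, fun i => hG (hf i), rfl⟩

theorem monomial_mem_degLE {S : Finset (Fin n)} {k : ℕ} (h : S.card ≤ k) :
    monomial S ∈ degLE n k := Submodule.subset_span ⟨S, h, rfl⟩

theorem one_mem_degLE (k : ℕ) : (1 : MajoranaAlgebra n) ∈ degLE n k :=
  monomial_mem_degLE (S := ∅) (by simp)

theorem degLE_mono {k l : ℕ} (h : k ≤ l) : degLE n k ≤ degLE n l :=
  Submodule.span_mono fun _ ⟨S, hS, e⟩ => ⟨S, hS.trans h, e⟩

theorem relaxationValue_anti {G G' : Submodule ℂ (MajoranaAlgebra n)} (hG : G ≤ G')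
    (h : MajoranaAlgebra n) : relaxationValue G' h ≤ relaxationValue G h := by
  refine sSup_le_sSup ?_
  rintro x ⟨E, hE, rfl⟩
  exact ⟨E, ⟨hE.map_star, hE.map_one, fun a ha => hE.nonneg a (ha.mono hG)⟩, rfl⟩

theorem relaxationValue_le_of_isSOS {G : Submodule ℂ (MajoranaAlgebra n)} {h : MajoranaAlgebra n}
    {r : ℝ} (hr : IsSOS G ((r : ℂ) • (1 : MajoranaAlgebra n) - h)) :
    relaxationValue G h ≤ (r : EReal) := by
  refine sSup_le ?_
  rintro x ⟨E, hE, rfl⟩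
  have := hE.nonneg _ hr
  rw [map_sub, map_smul, hE.map_one] at this
  simp at this
  exact_mod_cast this

/-! ### Commutation of monomials -/

/-- Each `(s, t)` with `s ≠ t` contributes exactly one `-1` to the product of the two signs, and `s
= t` contributes none; the intersection factor corrects for the latter. -/
theorem crossSign_mul_swap (S T : Finset (Fin n)) :
    crossSign S T * crossSign T S = (-1) ^ (S.card * T.card) * (-1) ^ (S ∩ T).card := by
  have h1 : crossSign T S = ∏ s ∈ S, ∏ t ∈ T, if s < t then -1 else 1 := Finset.prod_comm
  have h2 : ((-1 : ℂ)) ^ (S ∩ T).card = ∏ s ∈ S, ∏ t ∈ T, if s = t then -1 else 1 := by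
    simp [Finset.prod_ite_eq]
  have h3 : ((-1 : ℂ)) ^ (S.card * T.card) = ∏ s ∈ S, ∏ t ∈ T, (-1) := by
    simp [pow_mul']
  rw [h1, h2, h3, crossSign]
  simp only [← Finset.prod_mul_distrib]
  refine Finset.prod_congr rfl fun s _ => Finset.prod_congr rfl fun t _ => ?_
  rcases lt_trichotomy s t with h | h | h
  · simp [h, h.not_gt, h.ne]
  · simp [h]
  · simp [h, h.not_gt, h.ne']

theorem monomial_mul_comm (S T : Finset (Fin n)) :
    (monomial S * monomial T : MajoranaAlgebra n) =
      ((-1 : ℂ) ^ (S.card * T.card) * (-1) ^ (S ∩ T).card) • (monomial T * monomial S) := by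
  rw [monomial_mul_monomial, monomial_mul_monomial, smul_smul, ← crossSign_mul_swap, mul_assoc,
    crossSign_mul_self, mul_one, symmDiff_comm]

theorem monomial_mul_self (S : Finset (Fin n)) :
    (monomial S * monomial S : MajoranaAlgebra n) = ((-1 : ℂ) ^ S.card.choose 2) • 1 := by
  rw [monomial_mul_monomial, crossSign_self, symmDiff_self]; rfl

theorem star_monomial (S : Finset (Fin n)) :
    star (monomial S : MajoranaAlgebra n) = ((-1 : ℂ) ^ S.card.choose 2) • monomial S := by
  ext U
  rw [star_apply, smul_apply, monomial_apply]
  split_ifs with h <;> simp [h]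

theorem star_monomial_mul_self (S : Finset (Fin n)) :
    star (monomial S : MajoranaAlgebra n) * monomial S = 1 := by
  rw [star_monomial, smul_mul_assoc, monomial_mul_self, smul_smul, ← pow_add, ← two_mul]
  simp

theorem chi_mul_monomial (i : Fin n) {S : Finset (Fin n)} (hS : S.card = 4) :
    (chi i * monomial S : MajoranaAlgebra n) =
      if i ∈ S then -(monomial S * chi i) else monomial S * chi i := by
  rw [chi, monomial_mul_comm, hS]
  split_ifs with h
  · rw [Finset.singleton_inter_of_mem h]; norm_num
  · rw [Finset.singleton_inter_of_notMem h]; norm_num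

/-! ### Parts of a quartic element -/

/-- The coefficients of a real homogeneous quartic element. -/
abbrev Quartic (n : ℕ) : Type := {S : Finset (Fin n) // S.card = 4} → ℝ

/-- The part of `∑ c_S χ^S` supported on the sets containing `U`. -/
noncomputable def part (c : Quartic n) (U : Finset (Fin n)) : MajoranaAlgebra n :=
  ∑ S, if U ⊆ S.1 then (c S : ℂ) • monomial S.1 else 0

theorem star_part (c : Quartic n) (U : Finset (Fin n)) : star (part c U) = part c U := by
  unfold part
  rw [star_sum]
  refine Finset.sum_congr rfl fun S _ => ?_
  split_ifs
  · rw [star_smul, star_monomial, S.2, Complex.star_def, Complex.conj_ofReal]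
    norm_num [Nat.choose]
  · simp

theorem chi_mul_part (c : Quartic n) (i : Fin n) :
    chi i * part c {i} = -(part c {i} * chi i) := by
  unfold part
  rw [Finset.mul_sum, Finset.sum_mul, ← Finset.sum_neg_distrib]
  refine Finset.sum_congr rfl fun S _ => ?_
  by_cases h : i ∈ S.1
  · simp [h, chi_mul_monomial i S.2]
  · simp [h]

/-- The commutator kills the monomials that avoid `i`, which commute with `χ_i`, and doubles those
that contain it. -/
theorem part_empty_mul_chi_sub (c : Quartic n) (i : Fin n) :
    part c ∅ * chi i - chi i * part c ∅ = (2 : ℂ) • (part c {i} * chi i) := by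
  unfold part
  rw [Finset.mul_sum, Finset.sum_mul, Finset.sum_mul, ← Finset.sum_sub_distrib, Finset.smul_sum]
  refine Finset.sum_congr rfl fun S _ => ?_
  by_cases h : i ∈ S.1
  · simp [h, chi_mul_monomial i S.2, two_smul]
  · simp [h, chi_mul_monomial i S.2]

theorem tau_part (c : Quartic n) (i : Fin n) :
    tau (part c ∅) i = ((√n / 2 : ℝ) : ℂ) • (part c {i} * chi i) := by
  rw [tau, part_empty_mul_chi_sub, smul_smul]
  congr 1
  push_cast; ring

theorem sum_part_singleton (c : Quartic n) : ∑ i, part c {i} = (4 : ℂ) • part c ∅ := by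
  unfold part
  rw [Finset.sum_comm, Finset.smul_sum]
  refine Finset.sum_congr rfl fun S _ => ?_
  simp only [Finset.singleton_subset_iff, Finset.empty_subset, if_true]
  rw [Finset.sum_ite_mem, Finset.univ_inter, Finset.sum_const, S.2, ← Nat.cast_smul_eq_nsmul ℂ]
  norm_num

/-- Every monomial of `part c {i}` contains `i`, so multiplying by `χ_i` deletes a generator and
lowers the degree from 4 to 3. -/
theorem tau_mem_degLE (c : Quartic n) (i : Fin n) : tau (part c ∅) i ∈ degLE n 3 := by
  rw [tau_part]
  refine Submodule.smul_mem _ _ ?_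
  rw [part, Finset.sum_mul]
  refine Submodule.sum_mem _ fun S _ => ?_
  split_ifs with h
  · rw [smul_mul_assoc, chi, monomial_mul_monomial]
    refine Submodule.smul_mem _ _ (Submodule.smul_mem _ _ (monomial_mem_degLE ?_))
    have : S.1 ∆ {i} = S.1.erase i := by
      ext x
      simp only [Finset.mem_symmDiff, Finset.mem_singleton, Finset.mem_erase]
      have := Finset.singleton_subset_iff.1 h
      grind
    rw [this, Finset.card_erase_of_mem (Finset.singleton_subset_iff.1 h), S.2]
  · simp

theorem deg42_le_degLE (c : Quartic n) : deg42 (part c ∅) ≤ degLE n 3 := by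
  refine sup_le (degLE_mono (by norm_num)) (Submodule.span_le.2 ?_)
  rintro _ ⟨i, rfl⟩
  exact tau_mem_degLE c i

theorem sykHamiltonian_eq_part (J : Quartic n) :
    sykHamiltonian n J = part (fun S => 1 / √(n.choose 4) * J S) ∅ := by
  unfold sykHamiltonian part
  rw [Finset.smul_sum]
  refine Finset.sum_congr rfl fun S _ => ?_
  simp [-Complex.coe_smul, smul_smul]

/-! ### Quadratic identities between the parts -/

theorem part_mul_part (c : Quartic n) (U : Finset (Fin n)) :
    part c U * part c U = ∑ S, ∑ T, if U ⊆ S.1 ∩ T.1 then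
      ((c S * c T : ℝ) : ℂ) • (monomial S.1 * monomial T.1) else 0 := by
  unfold part
  rw [Finset.sum_mul_sum]
  refine Finset.sum_congr rfl fun S _ => Finset.sum_congr rfl fun T _ => ?_
  by_cases h1 : U ⊆ S.1 <;> by_cases h2 : U ⊆ T.1 <;>
    simp [-Complex.coe_smul, h1, h2, Finset.subset_inter_iff, smul_smul, mul_comm]

/-- A product `χ^S χ^T` appears once for every `k`-subset of `S ∩ T`. -/
theorem sum_part_sq_of_card (c : Quartic n) (k : ℕ) :
    ∑ P ∈ Finset.univ.powersetCard k, part c P * part c P =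
      ∑ S, ∑ T, (((S.1 ∩ T.1).card.choose k : ℝ) : ℂ) •
        (((c S * c T : ℝ) : ℂ) • (monomial S.1 * monomial T.1)) := by
  simp only [part_mul_part]
  rw [Finset.sum_comm]
  refine Finset.sum_congr rfl fun S _ => ?_
  rw [Finset.sum_comm]
  refine Finset.sum_congr rfl fun T _ => ?_
  rw [← Finset.sum_filter, Finset.sum_const, ← Nat.cast_smul_eq_nsmul ℂ,
    ← Finset.card_powersetCard]
  have : (Finset.univ.powersetCard k).filter (· ⊆ S.1 ∩ T.1) = (S.1 ∩ T.1).powersetCard k := by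
    ext P; simp [Finset.mem_powersetCard, and_comm]
  rw [this]; simp

/-- In twice the pair sum minus the singleton sum, `χ^S χ^T` has weight `k(k - 2)` with `k = |S ∩
T|`. This vanishes for `k = 0, 2`; for odd `k` the monomials anticommute, so `(S, T)` and `(T, S)`
cancel. Only `S = T` survives, with weight 8. -/
theorem two_mul_sum_part_pair_sq (c : Quartic n) :
    (2 : ℂ) • ∑ P ∈ Finset.univ.powersetCard 2, part c P * part c P =
      ∑ i, part c {i} * part c {i} + ((8 * ∑ S, c S ^ 2 : ℝ) : ℂ) • (1 : MajoranaAlgebra n) := by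
  have h1 : ∑ i, part c {i} * part c {i} =
      ∑ P ∈ Finset.univ.powersetCard 1, part c P * part c P := by
    rw [Finset.powersetCard_one, Finset.sum_map]; rfl
  let w : ℕ → ℂ := fun k => 2 * (k.choose 2 : ℂ) - k
  let X : {S : Finset (Fin n) // S.card = 4} → {S : Finset (Fin n) // S.card = 4} →
    MajoranaAlgebra n := fun S T =>
      w (S.1 ∩ T.1).card • (((c S * c T : ℝ) : ℂ) • (monomial S.1 * monomial T.1))
  have h2 : (2 : ℂ) • ∑ P ∈ Finset.univ.powersetCard 2, part c P * part c P -
      ∑ i, part c {i} * part c {i} = ∑ S, ∑ T, X S T := by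
    rw [h1, sum_part_sq_of_card, sum_part_sq_of_card]
    simp only [Finset.smul_sum, ← Finset.sum_sub_distrib]
    refine Finset.sum_congr rfl fun S _ => Finset.sum_congr rfl fun T _ => ?_
    rw [smul_smul, ← sub_smul]
    simp [X, w]
  have h3 : ∀ S T, X S T + X T S =
      if S = T then ((16 * c S ^ 2 : ℝ) : ℂ) • (1 : MajoranaAlgebra n) else 0 := by
    intro S T
    have hc := monomial_mul_comm S.1 T.1
    split_ifs with h
    · subst h
      simp only [X, w, Finset.inter_self, S.2, monomial_mul_self, ← add_smul, smul_smul]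
      congr 1
      norm_num [Nat.choose]; ring
    · have hk : (S.1 ∩ T.1).card < 4 := by
        refine lt_of_lt_of_eq ?_ S.2
        refine Finset.card_lt_card ((Finset.inter_subset_left).ssubset_of_ne fun e => h ?_)
        refine Subtype.ext (Finset.eq_of_subset_of_card_le (Finset.inter_eq_left.1 e) ?_)
        rw [S.2, T.2]
      simp only [X]
      rw [hc, S.2, T.2, Finset.inter_comm T.1 S.1, mul_comm (c T)]
      generalize (S.1 ∩ T.1).card = k at hk ⊢
      interval_cases k <;> norm_num [w, Nat.choose]
  -- Symmetrizing in `(S, T)` makes the cancellation termwise.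
  have h4 : (2 : ℂ) • ∑ S, ∑ T, X S T = (2 : ℂ) • (((8 * ∑ S, c S ^ 2 : ℝ) : ℂ) • 1) := by
    rw [two_smul]
    nth_rewrite 2 [Finset.sum_comm]
    simp only [← Finset.sum_add_distrib, h3, Finset.sum_ite_eq, Finset.mem_univ, if_true]
    rw [← Finset.sum_smul, smul_smul]
    congr 1
    push_cast
    rw [Finset.mul_sum, Finset.mul_sum]
    exact Finset.sum_congr rfl fun _ _ => by ring
  have h5 := smul_right_injective _ (two_ne_zero' ℂ) h4
  rw [← h5, ← h2]; abel

/-- Both cross terms equal `-(√n/2) h_i`, because `χ_i h_i χ_i = -h_i`; thus `h` enters a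
certificate linearly. -/
theorem star_chi_add_tau_mul_self (c : Quartic n) (i : Fin n) :
    star (chi i + tau (part c ∅) i) * (chi i + tau (part c ∅) i) =
      1 - ((√n : ℝ) : ℂ) • part c {i} + ((n / 4 : ℝ) : ℂ) • (part c {i} * part c {i}) := by
  have h := chi_mul_part c i
  have h' : part c {i} * chi i = -(chi i * part c {i}) := by rw [h, neg_neg]
  have e1 : chi i * (part c {i} * chi i) = - part c {i} := by
    rw [h', mul_neg, ← mul_assoc, chi_mul_self, one_mul]
  have e2 : chi i * part c {i} * chi i = - part c {i} := by rw [mul_assoc, e1]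
  have e3 : chi i * part c {i} * (part c {i} * chi i) = part c {i} * part c {i} := by
    rw [h, neg_mul, mul_assoc, e1, mul_neg, neg_neg]
  have hn : (√n : ℝ) * √n = n := Real.mul_self_sqrt (Nat.cast_nonneg n)
  rw [tau_part, star_add, star_smul, star_mul, star_part, star_chi, Complex.star_def,
    Complex.conj_ofReal, add_mul, mul_add, mul_add, smul_mul_smul_comm, mul_smul_comm,
    smul_mul_assoc, e1, e2, e3, chi_mul_self]
  have e4 : ((√n / 2 : ℝ) : ℂ) * ((√n / 2 : ℝ) : ℂ) = ((n / 4 : ℝ) : ℂ) := by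
    rw [← Complex.ofReal_mul]; congr 1; linear_combination hn / 4
  have e5 : ((√n : ℝ) : ℂ) = ((√n / 2 : ℝ) : ℂ) + ((√n / 2 : ℝ) : ℂ) := by push_cast; ring
  rw [e4, e5, add_smul, smul_neg]
  abel

/-- The main identity behind the certificate. -/
theorem four_sqrt_smul_part_empty (c : Quartic n) :
    ((4 * √n : ℝ) : ℂ) • part c ∅ +
        ∑ i, star (chi i + tau (part c ∅) i) * (chi i + tau (part c ∅) i) +
        ((2 * n * ∑ S, c S ^ 2 : ℝ) : ℂ) • (1 : MajoranaAlgebra n) =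
      ((n : ℝ) : ℂ) • (1 : MajoranaAlgebra n) +
        ((n / 2 : ℝ) : ℂ) • ∑ P ∈ Finset.univ.powersetCard 2, part c P * part c P := by
  have h := congrArg (((n / 4 : ℝ) : ℂ) • ·) (two_mul_sum_part_pair_sq c)
  simp only [star_chi_add_tau_mul_self, Finset.sum_add_distrib, Finset.sum_sub_distrib,
    ← Finset.smul_sum, sum_part_singleton, smul_add, smul_smul] at h ⊢
  have e : ((n / 4 : ℝ) : ℂ) * 2 = ((n / 2 : ℝ) : ℂ) := by push_cast; ring
  rw [e] at h
  rw [h, Finset.sum_const, Finset.card_univ, Fintype.card_fin, ← Nat.cast_smul_eq_nsmul ℂ]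
  push_cast
  module

/-! ### The flattening of a quartic element to a matrix indexed by pairs -/

/-- The two-element subsets of `Fin n`. -/
abbrev Pair (n : ℕ) : Type := {P : Finset (Fin n) // P.card = 2}

theorem card_pair (n : ℕ) : Fintype.card (Pair n) = n.choose 2 := by
  rw [Fintype.card_finset_len, Fintype.card_fin]

/-- Two pairs whose symmetric difference has four elements must be disjoint. -/
theorem subset_of_eq_symmDiff {P Q S : Finset (Fin n)} (hP : P.card = 2) (hQ : Q.card = 2)
    (hS : S.card = 4) (h : S = P ∆ Q) : P ⊆ S := by
  have h1 : S.card ≤ (P \ Q).card + (Q \ P).card := by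
    rw [h]; exact Finset.card_union_le _ _
  have h2 : (P \ Q).card ≤ P.card := Finset.card_le_card Finset.sdiff_subset
  have h3 : (Q \ P).card ≤ Q.card := Finset.card_le_card Finset.sdiff_subset
  have h4 : P \ Q = P := Finset.eq_of_subset_of_card_le Finset.sdiff_subset (by omega)
  intro x hx
  rw [h]
  rw [← h4] at hx
  exact Finset.mem_symmDiff.2 (Or.inl (Finset.mem_sdiff.1 hx))

/-- The real sign `crossSign S T`. -/
noncomputable def realSign (S T : Finset (Fin n)) : ℝ := (crossSign S T).re

theorem ofReal_realSign (S T : Finset (Fin n)) : ((realSign S T : ℝ) : ℂ) = crossSign S T :=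
  Complex.conj_eq_iff_re.1 (conj_crossSign S T)

theorem realSign_sq (S T : Finset (Fin n)) : realSign S T ^ 2 = 1 := by
  have h := crossSign_mul_self S T
  rw [← ofReal_realSign] at h
  rw [sq]
  exact_mod_cast h

/-- The matrix with entry `± c_{P ∪ Q}` for disjoint pairs `P`, `Q`, and `0` otherwise. -/
noncomputable def pairMatrix (c : Quartic n) : Matrix (Pair n) (Pair n) ℝ :=
  fun P Q => ∑ S, if S.1 = P.1 ∆ Q.1 then realSign S.1 P.1 * c S else 0

/-- Multiplication by `χ^P` removes `P` from every monomial of `part c P`, leaving a quadratic whose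
coefficients form a row of the flattening. -/
theorem part_mul_monomial (c : Quartic n) (P : Pair n) :
    part c P.1 * monomial P.1 = ∑ Q : Pair n, ((pairMatrix c P Q : ℝ) : ℂ) • monomial Q.1 := by
  simp only [pairMatrix, part, Complex.ofReal_sum, Finset.sum_smul, Finset.sum_mul]
  rw [Finset.sum_comm]
  refine Finset.sum_congr rfl fun S _ => ?_
  split_ifs with h
  · have h2 : S.1 ∆ P.1 = S.1 \ P.1 := by
      rw [symmDiff_def, Finset.sup_eq_union, Finset.sdiff_eq_empty_iff_subset.2 h,
        Finset.union_empty]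
    have h3 : (S.1 ∆ P.1).card = 2 := by
      rw [h2, Finset.card_sdiff_of_subset h, S.2, P.2]
    rw [Finset.sum_eq_single (⟨S.1 ∆ P.1, h3⟩ : Pair n)]
    · rw [if_pos (by simp [symmDiff_comm S.1]), smul_mul_assoc,
        monomial_mul_monomial, smul_smul, Complex.ofReal_mul, ofReal_realSign, mul_comm]
    · intro Q _ hQ
      rw [if_neg, Complex.ofReal_zero, zero_smul]
      intro e
      refine hQ (Subtype.ext ?_)
      simp only [e]
      rw [symmDiff_comm, symmDiff_symmDiff_cancel_left]
    · simp
  · rw [zero_mul]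
    refine (Finset.sum_eq_zero fun Q _ => ?_).symm
    rw [if_neg, Complex.ofReal_zero, zero_smul]
    exact fun e => h (subset_of_eq_symmDiff P.2 Q.2 S.2 e)

/-- Each quartic monomial containing `P` meets it in two elements, so it commutes with `χ^P`, which
is unitary. Thus `h_P²` is the square of a quadratic. -/
theorem star_part_mul_monomial_mul_self (c : Quartic n) (P : Pair n) :
    star (part c P.1 * monomial P.1) * (part c P.1 * monomial P.1) = part c P.1 * part c P.1 := by
  have h : part c P.1 * monomial P.1 = monomial P.1 * part c P.1 := by
    unfold part
    rw [Finset.mul_sum, Finset.sum_mul]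
    refine Finset.sum_congr rfl fun S _ => ?_
    split_ifs with h
    · rw [smul_mul_assoc, mul_smul_comm, monomial_mul_comm, S.2, P.2, Finset.inter_comm,
        Finset.inter_eq_left.2 h, P.2]
      norm_num
    · simp
  calc _ = star (part c P.1 * monomial P.1) * (monomial P.1 * part c P.1) := by rw [← h]
    _ = star (monomial P.1 * part c P.1) * (monomial P.1 * part c P.1) := by rw [← h]
    _ = part c P.1 * (star (monomial P.1) * monomial P.1) * part c P.1 := by
      rw [star_mul, star_part]; noncomm_ring
    _ = _ := by rw [star_monomial_mul_self, mul_one]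

/-! ### From matrix bounds to sums of squares -/

/-- A positive semidefinite quadratic form in elements of `G` is a sum of squares. -/
theorem isSOS_of_posSemidef {ι : Type*} [Fintype ι] {G : Submodule ℂ (MajoranaAlgebra n)}
    {g : ι → MajoranaAlgebra n} (hg : ∀ i, g i ∈ G) {M : Matrix ι ι ℝ} (hM : M.PosSemidef) :
    IsSOS G (∑ i, ∑ j, ((M i j : ℝ) : ℂ) • (star (g i) * g j)) := by
  obtain ⟨m, v, rfl⟩ := Matrix.posSemidef_iff_eq_sum_vecMulVec.1 hM
  have : ∑ i, ∑ j, (((∑ k, Matrix.vecMulVec (v k) (star (v k))) i j : ℝ) : ℂ) •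
      (star (g i) * g j) =
      ∑ k, star (∑ i, ((v k i : ℝ) : ℂ) • g i) * ∑ i, ((v k i : ℝ) : ℂ) • g i := by
    simp only [star_sum, star_smul, Finset.sum_mul_sum, Matrix.sum_apply, Matrix.vecMulVec_apply,
      Complex.ofReal_sum, Finset.sum_smul]
    refine ((Finset.sum_congr rfl fun i _ => Finset.sum_comm).trans Finset.sum_comm).trans ?_
    refine Finset.sum_congr rfl fun k _ => Finset.sum_congr rfl fun i _ =>
      Finset.sum_congr rfl fun j _ => ?_
    simp [-Complex.coe_smul, smul_smul, mul_comm]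
  rw [this]
  exact IsSOS.sum _ fun k _ => isSOS_star_mul_self
    (Submodule.sum_mem _ fun i _ => Submodule.smul_mem _ _ (hg i))

/-- A bound on the norm of `A` bounds `∑_P |∑_Q A_PQ g_Q|²` by sums of squares. -/
theorem isSOS_sub_sum_of_mulVec_le {ι : Type*} [Fintype ι] [DecidableEq ι]
    {G : Submodule ℂ (MajoranaAlgebra n)} {g : ι → MajoranaAlgebra n} (hg : ∀ i, g i ∈ G)
    {A : Matrix ι ι ℝ} {K : ℝ} (hA : ∀ v : ι → ℝ, ∑ i, (A.mulVec v i) ^ 2 ≤ K * ∑ i, v i ^ 2) :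
    IsSOS G ((K : ℂ) • ∑ i, star (g i) * g i -
      ∑ i, star (∑ j, ((A i j : ℝ) : ℂ) • g j) * ∑ j, ((A i j : ℝ) : ℂ) • g j) := by
  -- The norm bound on `A` says exactly that `K - AᵀA` is positive semidefinite; the claim is the
  -- associated form in the `g i`.
  have hM : (K • (1 : Matrix ι ι ℝ) - A.transpose * A).PosSemidef := by
    refine .of_dotProduct_mulVec_nonneg ?_ fun x => ?_
    · ext i j
      simp [Matrix.mul_apply, Matrix.one_apply, eq_comm, mul_comm]
    · have h := hA x
      rw [Matrix.sub_mulVec, dotProduct_sub, ← Matrix.mulVec_mulVec,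
        Matrix.dotProduct_mulVec _ A.transpose, Matrix.vecMul_transpose, Matrix.smul_mulVec,
        Matrix.one_mulVec, dotProduct_smul]
      simp only [dotProduct, star_trivial, smul_eq_mul, ← sq]
      linarith
  convert isSOS_of_posSemidef hg hM using 1
  simp only [Matrix.sub_apply, Matrix.smul_apply, Matrix.one_apply, Matrix.mul_apply,
    Matrix.transpose_apply, Complex.ofReal_sub, sub_smul, Finset.sum_sub_distrib, smul_eq_mul,
    mul_ite, mul_one, mul_zero]
  congr 1
  · rw [Finset.smul_sum]
    refine Finset.sum_congr rfl fun i _ => ?_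
    rw [Finset.sum_eq_single i]
    · simp
    · intro j _ hj; simp [hj.symm]
    · simp
  · simp only [star_sum, star_smul, Finset.sum_mul_sum, Complex.ofReal_sum, Finset.sum_smul]
    rw [Finset.sum_comm]
    refine Finset.sum_congr rfl fun i _ => ?_
    rw [Finset.sum_comm]
    refine Finset.sum_congr rfl fun j _ => Finset.sum_congr rfl fun k _ => ?_
    rw [smul_mul_smul_comm, Complex.star_def, Complex.conj_ofReal, Complex.ofReal_mul]

/-- The degree-`(4,2)` certificate for a quartic element whose flattening is bounded. -/
theorem isSOS_deg42_of_mulVec_le (hn : 0 < n) (c : Quartic n) {K C : ℝ}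
    (hA : ∀ v, ∑ P, ((pairMatrix c).mulVec v P) ^ 2 ≤ K * ∑ P, v P ^ 2)
    (hC : 1 + K * n.choose 2 / 2 ≤ 4 * C) :
    IsSOS (deg42 (part c ∅)) (((C * √n : ℝ) : ℂ) • (1 : MajoranaAlgebra n) - part c ∅) := by
  have hn' : (0 : ℝ) < n := Nat.cast_pos.2 hn
  have hs : (0 : ℝ) < √n := Real.sqrt_pos.2 hn'
  have hss : √n * √n = (n : ℝ) := Real.mul_self_sqrt hn'.le
  have hle : degLE n 2 ≤ deg42 (part c ∅) := le_sup_left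
  have hP : IsSOS (deg42 (part c ∅)) ((K : ℂ) • ((n.choose 2 : ℝ) : ℂ) • (1 : MajoranaAlgebra n) -
      ∑ P ∈ Finset.univ.powersetCard 2, part c P * part c P) := by
    have := isSOS_sub_sum_of_mulVec_le (G := deg42 (part c ∅))
      (g := fun Q : Pair n => monomial Q.1) (fun Q => hle (monomial_mem_degLE Q.2.le)) hA
    simp only [← part_mul_monomial, star_part_mul_monomial_mul_self, star_monomial_mul_self,
      Finset.sum_const, Finset.card_univ, card_pair] at this
    rw [Finset.sum_subtype (p := fun P => P.card = 2) _ (by simp [Finset.mem_powersetCard])]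
    rw [← Nat.cast_smul_eq_nsmul ℂ] at this
    simpa using this
  have h1 : IsSOS (deg42 (part c ∅)) (1 : MajoranaAlgebra n) := by
    simpa using isSOS_star_mul_self (hle (one_mem_degLE (n := n) 2))
  have hT : IsSOS (deg42 (part c ∅))
      (∑ i, star (chi i + tau (part c ∅) i) * (chi i + tau (part c ∅) i)) :=
    IsSOS.sum _ fun i _ => isSOS_star_mul_self <| Submodule.add_mem _
      (hle (monomial_mem_degLE (by simp)))
      (Submodule.mem_sup_right (Submodule.subset_span ⟨i, rfl⟩))
  -- The scalar left over after the squares are removed is `n` times the slack in `hC`, plus the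
  -- nonnegative coefficient sum.
  have hr : 0 ≤ 4 * C * n + 2 * n * ∑ S, c S ^ 2 - n - n / 2 * (K * n.choose 2) := by
    have : 0 ≤ 2 * (n : ℝ) * ∑ S, c S ^ 2 := by positivity
    nlinarith
  have key := (((h1.smul hr).add (hP.smul (r := n / 2) (by positivity))).add hT).smul
    (r := 1 / (4 * √n)) (by positivity)
  convert key using 1
  have e := four_sqrt_smul_part_empty c
  have e' : part c ∅ = ((1 / (4 * √n) : ℝ) : ℂ) • (((4 * √n : ℝ) : ℂ) • part c ∅) := by
    rw [smul_smul, ← Complex.ofReal_mul, one_div_mul_cancel (by positivity), Complex.ofReal_one,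
      one_smul]
  have e2 : ((C * √n : ℝ) : ℂ) • (1 : MajoranaAlgebra n) =
      ((1 / (4 * √n) : ℝ) : ℂ) • (((4 * C * n : ℝ) : ℂ) • (1 : MajoranaAlgebra n)) := by
    rw [smul_smul, ← Complex.ofReal_mul]
    congr 2
    field_simp
    linear_combination C * hss
  conv_lhs => rw [e2, e', ← smul_sub]
  congr 1
  rw [add_assoc, ← eq_sub_iff_add_eq] at e
  rw [e]
  push_cast
  module

/-! ### Nets of the Euclidean unit ball and norms of matrices -/

/-- The closed unit ball of a finite-dimensional Euclidean space has a `1/2`-net of at most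
`5 ^ dim` points. -/
theorem exists_net (ι : Type*) [Fintype ι] :
    ∃ s : Finset (EuclideanSpace ℝ ι), s.card ≤ 5 ^ Fintype.card ι ∧ (∀ x ∈ s, ‖x‖ ≤ 1) ∧
      ∀ y, ‖y‖ ≤ 1 → ∃ x ∈ s, ‖y - x‖ ≤ 1 / 2 := by
  classical
  -- The net is half of a largest 1-separated set in the ball of radius 2, the scale at which the
  -- packing bound `5 ^ dim` applies.
  let p : Finset (EuclideanSpace ℝ ι) → Prop := fun s =>
    (∀ c ∈ s, ‖c‖ ≤ 2) ∧ ∀ c ∈ s, ∀ d ∈ s, c ≠ d → 1 ≤ ‖c - d‖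
  have hcard : ∀ s, p s → s.card ≤ 5 ^ Fintype.card ι := fun s hs => by
    have := Besicovitch.card_le_of_separated s hs.1 hs.2
    rwa [finrank_euclideanSpace] at this
  let q : ℕ → Prop := fun m => ∃ s, p s ∧ s.card = m
  have hq : q (Nat.findGreatest q (5 ^ Fintype.card ι)) :=
    Nat.findGreatest_spec (P := q) (Nat.zero_le _) ⟨∅, by simp [p], by simp⟩
  obtain ⟨s, hs, hsm⟩ := hq
  have hmax : ∀ t, p t → t.card ≤ s.card := fun t ht =>
    hsm ▸ Nat.le_findGreatest (hcard t ht) ⟨t, ht, rfl⟩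
  refine ⟨s.image ((1 / 2 : ℝ) • ·), Finset.card_image_le.trans (hcard s hs), ?_, ?_⟩
  · intro x hx
    obtain ⟨z, hz, rfl⟩ := Finset.mem_image.1 hx
    rw [norm_smul]
    have := hs.1 z hz
    norm_num; linarith
  · intro y hy
    by_contra! h
    have hfar : ∀ z ∈ s, 1 < ‖(2 : ℝ) • y - z‖ := fun z hz => by
      have h1 := h _ (Finset.mem_image_of_mem _ hz)
      have h2 : (2 : ℝ) • y - z = (2 : ℝ) • (y - (1 / 2 : ℝ) • z) := by
        rw [smul_sub, smul_smul]; norm_num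
      rw [h2, norm_smul]
      norm_num at h1 ⊢; linarith
    have hnot : (2 : ℝ) • y ∉ s := fun hmem => by
      have := hfar _ hmem
      norm_num at this
    have hp : p (insert ((2 : ℝ) • y) s) := by
      refine ⟨fun c hc => ?_, fun c hc d hd hcd => ?_⟩
      · rcases Finset.mem_insert.1 hc with rfl | hc
        · rw [norm_smul]; norm_num; linarith
        · exact hs.1 c hc
      · rcases Finset.mem_insert.1 hc with rfl | hc <;> rcases Finset.mem_insert.1 hd with rfl | hd
        · exact absurd rfl hcd
        · exact (hfar d hd).le
        · rw [norm_sub_rev]; exact (hfar c hc).le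
        · exact hs.2 c hc d hd hcd
    have := hmax _ hp
    rw [Finset.card_insert_of_notMem hnot] at this
    omega

/-- If `x` is a net point within `1/2` of `w/‖w‖`, then `‖w‖ = ⟨w/‖w‖, w⟩ ≤ t + ‖w‖/2`. -/
theorem norm_le_of_net {E : Type*} [NormedAddCommGroup E] [InnerProductSpace ℝ E]
    {s : Finset E} (hs : ∀ y, ‖y‖ ≤ 1 → ∃ x ∈ s, ‖y - x‖ ≤ 1 / 2) {w : E} {t : ℝ}
    (hw : ∀ x ∈ s, inner ℝ x w ≤ t) : ‖w‖ ≤ 2 * t := by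
  rcases eq_or_ne w 0 with rfl | h0
  · obtain ⟨x, hx, -⟩ := hs 0 (by simp)
    have := hw x hx
    simp at this ⊢; exact this
  · have hpos : 0 < ‖w‖ := norm_pos_iff.2 h0
    have h1 : ‖(‖w‖⁻¹) • w‖ = 1 := by
      rw [norm_smul, norm_inv, norm_norm, inv_mul_cancel₀ hpos.ne']
    obtain ⟨x, hx, hxy⟩ := hs _ h1.le
    have h2 : inner ℝ ((‖w‖⁻¹) • w) w = ‖w‖ := by
      rw [real_inner_smul_left, real_inner_self_eq_norm_sq]; field_simp
    have h3 := real_inner_le_norm ((‖w‖⁻¹) • w - x) w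
    rw [inner_sub_left, h2] at h3
    have h4 := hw x hx
    nlinarith

/-- A bilinear form bounded by `t` on a pair of `1/2`-nets has norm at most `4 t`. -/
theorem sum_mulVec_sq_le_of_net {ι : Type*} [Fintype ι] {s : Finset (EuclideanSpace ℝ ι)}
    (hs : ∀ y, ‖y‖ ≤ 1 → ∃ x ∈ s, ‖y - x‖ ≤ 1 / 2) {A : Matrix ι ι ℝ} {t : ℝ}
    (hA : ∀ x ∈ s, ∀ y ∈ s, ∑ i, ∑ j, x i * y j * A i j ≤ t) (v : ι → ℝ) :
    ∑ i, (A.mulVec v i) ^ 2 ≤ 16 * t ^ 2 * ∑ i, v i ^ 2 := by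
  classical
  -- The net is used once in each argument: first for `xᵀA` with `x` in the net, then for `A v` with
  -- `v` arbitrary. Each use costs a factor 2, whence 16 after squaring.
  have h1 : ∀ x ∈ s, ‖WithLp.toLp 2 (A.vecMul x.ofLp)‖ ≤ 2 * t := fun x hx => by
    refine norm_le_of_net hs fun y hy => (le_of_eq ?_).trans (hA x hx y hy)
    simp only [PiLp.inner_apply, Matrix.vecMul, dotProduct, RCLike.inner_apply, conj_trivial,
      Finset.sum_mul]
    rw [Finset.sum_comm]
    exact Finset.sum_congr rfl fun i _ => Finset.sum_congr rfl fun j _ => by ring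
  have h2 : ‖WithLp.toLp 2 (A.mulVec v)‖ ≤ 2 * (2 * t * ‖WithLp.toLp 2 v‖) := by
    refine norm_le_of_net hs fun x hx => ?_
    have h3 := real_inner_le_norm (WithLp.toLp 2 (A.vecMul x.ofLp)) (WithLp.toLp 2 v)
    have h4 : inner ℝ x (WithLp.toLp 2 (A.mulVec v)) =
        inner ℝ (WithLp.toLp 2 (A.vecMul x.ofLp)) (WithLp.toLp 2 v) := by
      have := Matrix.dotProduct_mulVec x.ofLp A v
      rw [EuclideanSpace.inner_eq_star_dotProduct, EuclideanSpace.inner_eq_star_dotProduct,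
        dotProduct_comm, star_trivial, star_trivial, dotProduct_comm v]
      exact this
    rw [h4]
    exact h3.trans (mul_le_mul_of_nonneg_right (h1 x hx) (norm_nonneg _))
  have h5 := pow_le_pow_left₀ (norm_nonneg _) h2 2
  rw [EuclideanSpace.real_norm_sq_eq] at h5
  refine h5.trans (le_of_eq ?_)
  rw [mul_pow, mul_pow, EuclideanSpace.real_norm_sq_eq]
  ring

/-! ### The Gaussian estimate -/

/-- The coefficient of `c_S` in the bilinear form of `pairMatrix c` at `x`, `y`. -/
noncomputable def pairCoeff (x y : Pair n → ℝ) (S : {S : Finset (Fin n) // S.card = 4}) : ℝ :=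
  ∑ P, ∑ Q, if S.1 = P.1 ∆ Q.1 then realSign S.1 P.1 * (x P * y Q) else 0

theorem sum_mul_pairMatrix (c : Quartic n) (x y : Pair n → ℝ) :
    ∑ P, ∑ Q, x P * y Q * pairMatrix c P Q = ∑ S, pairCoeff x y S * c S := by
  simp only [pairMatrix, pairCoeff, Finset.mul_sum, Finset.sum_mul]
  refine ((Finset.sum_congr rfl fun P _ => Finset.sum_comm).trans Finset.sum_comm).trans ?_
  refine Finset.sum_congr rfl fun S _ => Finset.sum_congr rfl fun P _ =>
    Finset.sum_congr rfl fun Q _ => ?_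
  split_ifs <;> ring

/-- Cauchy–Schwarz over the ordered splittings of `S` into two pairs; a splitting is determined by
its first pair, one of the six in `S`. -/
theorem pairCoeff_sq_le (x y : Pair n → ℝ) (S : {S : Finset (Fin n) // S.card = 4}) :
    pairCoeff x y S ^ 2 ≤
      6 * ∑ P, ∑ Q, if S.1 = P.1 ∆ Q.1 then x P ^ 2 * y Q ^ 2 else 0 := by
  let F : Finset (Pair n × Pair n) := Finset.univ.filter fun p => S.1 = p.1.1 ∆ p.2.1
  have hF : F.card ≤ 6 := by
    have h6 : (S.1.powersetCard 2).card = 6 := by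
      rw [Finset.card_powersetCard, S.2]; rfl
    rw [← h6]
    refine Finset.card_le_card_of_injOn (fun p => p.1.1) ?_ ?_
    · rintro ⟨P, Q⟩ hp
      have hp : S.1 = P.1 ∆ Q.1 := (Finset.mem_filter.1 hp).2
      exact Finset.mem_powersetCard.2 ⟨subset_of_eq_symmDiff P.2 Q.2 S.2 hp, P.2⟩
    · rintro ⟨P, Q⟩ hp ⟨P', Q'⟩ hp' (e : P.1 = P'.1)
      have hp : S.1 = P.1 ∆ Q.1 := (Finset.mem_filter.1 hp).2
      have hp' : S.1 = P'.1 ∆ Q'.1 := (Finset.mem_filter.1 hp').2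
      rw [hp, e] at hp'
      exact Prod.ext (Subtype.ext e) (Subtype.ext (symmDiff_right_injective _ hp'))
  have h1 : pairCoeff x y S = ∑ p ∈ F, realSign S.1 p.1.1 * (x p.1 * y p.2) := by
    rw [pairCoeff, Finset.sum_filter, Fintype.sum_prod_type]
  have h2 : (∑ P, ∑ Q, if S.1 = P.1 ∆ Q.1 then x P ^ 2 * y Q ^ 2 else 0) =
      ∑ p ∈ F, (realSign S.1 p.1.1 * (x p.1 * y p.2)) ^ 2 := by
    simp only [mul_pow, realSign_sq, one_mul]
    rw [Finset.sum_filter, Fintype.sum_prod_type]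
  rw [h1, h2]
  refine sq_sum_le_card_mul_sum_sq.trans ?_
  exact mul_le_mul_of_nonneg_right (by exact_mod_cast hF) (Finset.sum_nonneg fun _ _ => sq_nonneg _)

/-- Each `(P, Q)` splits at most one `S`, so the sum over `S` counts every product `x_P² y_Q²` at
most once. -/
theorem sum_pairCoeff_sq_le (x y : Pair n → ℝ) :
    ∑ S, pairCoeff x y S ^ 2 ≤ 6 * ((∑ P, x P ^ 2) * ∑ Q, y Q ^ 2) := by
  refine (Finset.sum_le_sum fun S _ => pairCoeff_sq_le x y S).trans ?_
  rw [← Finset.mul_sum, Finset.sum_mul_sum]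
  refine mul_le_mul_of_nonneg_left ?_ (by norm_num)
  rw [Finset.sum_comm]
  refine Finset.sum_le_sum fun P _ => ?_
  rw [Finset.sum_comm]
  refine Finset.sum_le_sum fun Q _ => ?_
  by_cases h : (P.1 ∆ Q.1).card = 4
  · rw [Finset.sum_eq_single (⟨_, h⟩ : {S : Finset (Fin n) // S.card = 4})]
    · simp
    · intro S _ hS
      exact if_neg fun e => hS (Subtype.ext e)
    · simp
  · rw [Finset.sum_eq_zero]
    · positivity
    · intro S _
      exact if_neg fun e => h (by rw [← e, S.2])

instance (n : ℕ) : IsProbabilityMeasure (sykMeasure n) := by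
  unfold sykMeasure; infer_instance

theorem hasSubgaussianMGF_sum_mul_gaussian {ι : Type*} [Fintype ι] (a : ι → ℝ) :
    HasSubgaussianMGF (fun J : ι → ℝ => ∑ i, a i * J i) (∑ i, (a i ^ 2).toNNReal)
      (Measure.pi fun _ : ι => gaussianReal 0 1) := by
  have hid : HasSubgaussianMGF (fun x : ℝ => x) 1 (gaussianReal 0 1) :=
    ⟨fun t => integrable_exp_mul_gaussianReal t, fun t => by rw [mgf_fun_id_gaussianReal]; simp⟩
  refine HasSubgaussianMGF.sum_of_iIndepFun
    (iIndepFun_pi (X := fun i (x : ℝ) => a i * x) fun i => by fun_prop) fun i _ => ?_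
  have h : HasSubgaussianMGF (fun x => a i * x) (a i ^ 2).toNNReal (gaussianReal 0 1) := by
    convert hid.const_mul (a i) using 1
    exact (Real.toNNReal_of_nonneg (sq_nonneg _)).trans (mul_one _).symm
  have hmp := measurePreserving_eval (fun _ : ι => gaussianReal 0 1) i
  refine ⟨fun t => (hmp.integrable_comp (h.integrable_exp_mul t).1).2 (h.integrable_exp_mul t),
    fun t => ?_⟩
  refine le_of_eq_of_le ?_ (h.mgf_le t)
  have hX : AEMeasurable (fun J : ι → ℝ => J i) (Measure.pi fun _ : ι => gaussianReal 0 1) :=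
    hmp.measurable.aemeasurable
  have hm := integral_map hX (f := fun x => Real.exp (t * (a i * x))) (by fun_prop)
  rw [hmp.map_eq] at hm
  exact hm.symm

/-- The bilinear form is a Gaussian sum of variance at most 6, hence the exponent `t² / (2 · 6)`. -/
theorem sykMeasure_le_of_norm_le_one {x y : Pair n → ℝ} (hx : ∑ P, x P ^ 2 ≤ 1)
    (hy : ∑ Q, y Q ^ 2 ≤ 1) {t : ℝ} (ht : 0 ≤ t) :
    (sykMeasure n).real {J | t ≤ ∑ P, ∑ Q, x P * y Q * pairMatrix J P Q} ≤
      Real.exp (-t ^ 2 / 12) := by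
  have h := hasSubgaussianMGF_sum_mul_gaussian (pairCoeff x y)
  have hle : ∑ S, pairCoeff x y S ^ 2 ≤ 6 := by
    refine (sum_pairCoeff_sq_le x y).trans ?_
    have := mul_le_one₀ hx (Finset.sum_nonneg fun _ _ => sq_nonneg _) hy
    linarith
  have h6 : HasSubgaussianMGF (fun J : Quartic n => ∑ S, pairCoeff x y S * J S) 6
      (sykMeasure n) := by
    refine ⟨h.integrable_exp_mul, fun t => (h.mgf_le t).trans (Real.exp_le_exp.2 ?_)⟩
    have e : ((∑ S, (pairCoeff x y S ^ 2).toNNReal : NNReal) : ℝ) =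
        ∑ S, pairCoeff x y S ^ 2 := by
      rw [NNReal.coe_sum]
      exact Finset.sum_congr rfl fun S _ => Real.coe_toNNReal _ (sq_nonneg _)
    rw [e]
    have := mul_le_mul_of_nonneg_right hle (sq_nonneg t)
    norm_num
    linarith
  simp only [sum_mul_pairMatrix]
  refine (h6.measure_ge_le ht).trans (le_of_eq ?_)
  norm_num

/-- With probability at least `1 - (25 / e⁴)^N`, `N = n choose 2`, the flattening has squared norm
at most `768 N`. -/
theorem sykMeasure_not_mulVec_le (n : ℕ) :
    (sykMeasure n).real {J | ¬ ∀ v, ∑ P, ((pairMatrix J).mulVec v P) ^ 2 ≤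
      768 * n.choose 2 * ∑ P, v P ^ 2} ≤ (25 * Real.exp (-4)) ^ n.choose 2 := by
  obtain ⟨s, hcard, hs1, hs⟩ := exists_net (Pair n)
  rw [card_pair] at hcard
  -- With `N = n choose 2`, this makes each tail at most `e^(-4N)`, enough to beat the `25^N` pairs
  -- of net points; and `16 t² = 768 N`.
  set t : ℝ := √(48 * n.choose 2) with ht
  have htsq : t ^ 2 = 48 * n.choose 2 := Real.sq_sqrt (by positivity)
  let B : EuclideanSpace ℝ (Pair n) × EuclideanSpace ℝ (Pair n) → Set (Quartic n) :=
    fun p => {J | t ≤ ∑ P, ∑ Q, p.1 P * p.2 Q * pairMatrix J P Q}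
  have hsub : {J : Quartic n | ¬ ∀ v, ∑ P, ((pairMatrix J).mulVec v P) ^ 2 ≤
      768 * n.choose 2 * ∑ P, v P ^ 2} ⊆ ⋃ p ∈ s ×ˢ s, B p := by
    intro J hJ
    by_contra hc
    refine hJ fun v => ?_
    have := sum_mulVec_sq_le_of_net hs (A := pairMatrix J) (t := t)
      (fun x hx y hy => ?_) v
    · rw [htsq] at this
      linarith
    · by_contra! hlt
      exact hc (Set.mem_biUnion (Finset.mem_coe.2 (Finset.mk_mem_product hx hy)) hlt.le)
  have hsq : ∀ x ∈ s, ∑ P, x P ^ 2 ≤ 1 := fun x hx => by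
    rw [← EuclideanSpace.real_norm_sq_eq]
    exact pow_le_one₀ (norm_nonneg _) (hs1 x hx)
  calc _ ≤ (sykMeasure n).real (⋃ p ∈ s ×ˢ s, B p) :=
      measureReal_mono hsub (measure_ne_top _ _)
    _ ≤ ∑ p ∈ s ×ˢ s, (sykMeasure n).real (B p) := measureReal_biUnion_finset_le _ _
    _ ≤ ∑ p ∈ s ×ˢ s, Real.exp (-4) ^ n.choose 2 := by
      refine Finset.sum_le_sum fun p hp => ?_
      obtain ⟨h1, h2⟩ := Finset.mem_product.1 hp
      refine (sykMeasure_le_of_norm_le_one (hsq _ h1) (hsq _ h2) (Real.sqrt_nonneg _)).trans ?_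
      rw [← ht, htsq, ← Real.exp_nat_mul]
      exact Real.exp_le_exp.2 (by linarith)
    _ = (s.card : ℝ) ^ 2 * Real.exp (-4) ^ n.choose 2 := by
      rw [Finset.sum_const, Finset.card_product, nsmul_eq_mul]; push_cast; ring
    _ ≤ ((5 : ℝ) ^ n.choose 2) ^ 2 * Real.exp (-4) ^ n.choose 2 := by
      gcongr
      exact_mod_cast hcard
    _ = _ := by rw [mul_pow, ← pow_mul, mul_comm (n.choose 2), pow_mul]; norm_num

/-! ### Asymptotics -/

theorem choose_two_sq_le {n : ℕ} (hn : 12 ≤ n) :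
    (n.choose 2 : ℝ) ^ 2 ≤ 12 * n.choose 4 := by
  obtain ⟨m, rfl⟩ := Nat.exists_eq_add_of_le hn
  have h2 : ((12 + m).choose 2 : ℝ) = (12 + m) * (11 + m) / 2 := by
    rw [Nat.cast_choose_two]; push_cast; ring
  have h4 : ((12 + m).choose 4 : ℝ) = (12 + m) * (11 + m) * (10 + m) * (9 + m) / 24 := by
    have h := Nat.descFactorial_eq_factorial_mul_choose (12 + m) 4
    simp only [Nat.descFactorial, show 12 + m - 3 = 9 + m by omega,
      show 12 + m - 2 = 10 + m by omega, show 12 + m - 1 = 11 + m by omega,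
      Nat.sub_zero, mul_one, show Nat.factorial 4 = 24 from rfl] at h
    have h' : ((9 + m) * ((10 + m) * ((11 + m) * (12 + m))) : ℝ) = 24 * (12 + m).choose 4 := by
      exact_mod_cast h
    linarith
  rw [h2, h4]
  have hm : (0 : ℝ) ≤ m := Nat.cast_nonneg m
  -- With `n = 12 + m`, the last factor is `2(n - 2)(n - 3) - n(n - 1) = n² - 9n + 12`.
  have : 0 ≤ ((12 + m) * (11 + m) : ℝ) * (m ^ 2 + 15 * m + 48) := by positivity
  nlinarith

theorem pairMatrix_smul (r : ℝ) (c : Quartic n) :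
    pairMatrix (fun S => r * c S) = r • pairMatrix c := by
  ext P Q
  simp only [pairMatrix, Matrix.smul_apply, smul_eq_mul, Finset.mul_sum]
  refine Finset.sum_congr rfl fun S _ => ?_
  split_ifs <;> ring

theorem isSOS_deg42_sykHamiltonian {n : ℕ} (hn : 12 ≤ n) {J : Quartic n}
    (hJ : ∀ v, ∑ P, ((pairMatrix J).mulVec v P) ^ 2 ≤ 768 * n.choose 2 * ∑ P, v P ^ 2) :
    IsSOS (deg42 (sykHamiltonian n J))
      (((2000 * √n : ℝ) : ℂ) • (1 : MajoranaAlgebra n) - sykHamiltonian n J) := by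
  have h4 : (0 : ℝ) < n.choose 4 := Nat.cast_pos.2 (Nat.choose_pos (by omega))
  rw [sykHamiltonian_eq_part]
  refine isSOS_deg42_of_mulVec_le (by omega) _ (K := 768 * n.choose 2 / n.choose 4) (fun v => ?_) ?_
  · rw [pairMatrix_smul]
    simp only [Matrix.smul_mulVec, Pi.smul_apply, smul_eq_mul, mul_pow, ← Finset.mul_sum]
    rw [div_pow, one_pow, Real.sq_sqrt h4.le, one_div, div_mul_eq_mul_div, div_eq_inv_mul]
    exact mul_le_mul_of_nonneg_left (hJ v) (by positivity)
  -- The requirement is `1 + 768 · 12 / 2 = 4609 ≤ 4 · 2000`.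
  · have h := choose_two_sq_le hn
    have : 768 * (n.choose 2 : ℝ) / n.choose 4 * n.choose 2 ≤ 768 * 12 := by
      rw [div_mul_eq_mul_div, div_le_iff₀ h4]
      linarith
    linarith

theorem tendsto_failure_bound :
    Tendsto (fun n : ℕ => (25 * Real.exp (-4)) ^ n.choose 2) atTop (𝓝 0) := by
  have h1 : 25 * Real.exp (-4) < 1 := by
    have h2 : (2.7 : ℝ) ^ 4 < Real.exp 4 := by
      have h3 : (2.7 : ℝ) < Real.exp 1 := by linarith [Real.exp_one_gt_d9]
      have h4 : Real.exp 4 = Real.exp 1 ^ 4 := by rw [← Real.exp_nat_mul]; norm_num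
      rw [h4]
      exact pow_lt_pow_left₀ h3 (by norm_num) (by norm_num)
    rw [Real.exp_neg, ← div_eq_mul_inv, div_lt_one (Real.exp_pos _)]
    norm_num at h2 ⊢; linarith
  refine (tendsto_pow_atTop_nhds_zero_of_lt_one (by positivity) h1).comp ?_
  refine tendsto_atTop_mono' _ ?_ tendsto_id
  -- From `n = 3` on, `n choose 2 ≥ n`, so the exponent tends to infinity.
  filter_upwards [eventually_ge_atTop 3] with n hn
  rw [id, Nat.choose_two_right, Nat.le_div_iff_mul_le two_pos]
  exact Nat.mul_le_mul_left n (by omega)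

end MajoranaAlgebra

theorem mainTheorem5 :
    (∀ (n : ℕ) (J : {S : Finset (Fin n) // S.card = 4} → ℝ),
      MajoranaAlgebra.opt (MajoranaAlgebra.sykHamiltonian n J) ≤
          MajoranaAlgebra.sosValue 3 (MajoranaAlgebra.sykHamiltonian n J) ∧
        MajoranaAlgebra.sosValue 3 (MajoranaAlgebra.sykHamiltonian n J) ≤
          MajoranaAlgebra.sos42Value (MajoranaAlgebra.sykHamiltonian n J)) ∧
    ∃ C : ℝ, 0 < C ∧
      Tendsto
        (fun n : ℕ => MajoranaAlgebra.sykMeasure n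
          {J | ¬ (MajoranaAlgebra.sos42Value (MajoranaAlgebra.sykHamiltonian n J) ≤
                  ((C * Real.sqrt n : ℝ) : EReal) ∧
                MajoranaAlgebra.sosValue 3 (MajoranaAlgebra.sykHamiltonian n J) ≤
                  ((C * Real.sqrt n : ℝ) : EReal) ∧
                MajoranaAlgebra.IsSOS (MajoranaAlgebra.degLE n 3)
                  (((C * Real.sqrt n : ℝ) : ℂ) • (1 : MajoranaAlgebra n) -
                    MajoranaAlgebra.sykHamiltonian n J))})
        atTop (𝓝 0) := by
  open MajoranaAlgebra in
  have hle : ∀ (n : ℕ) (J : Quartic n), deg42 (sykHamiltonian n J) ≤ degLE n 3 := fun n J => by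
    rw [sykHamiltonian_eq_part]; exact deg42_le_degLE _
  refine ⟨fun n J => ⟨relaxationValue_anti le_top _, relaxationValue_anti (hle n J) _⟩,
    2000, by norm_num, ?_⟩
  have hlim := ENNReal.tendsto_ofReal tendsto_failure_bound
  rw [ENNReal.ofReal_zero] at hlim
  refine tendsto_of_tendsto_of_tendsto_of_le_of_le' tendsto_const_nhds hlim
    (Eventually.of_forall fun _ => zero_le) ?_
  filter_upwards [eventually_ge_atTop 12] with n hn
  have hbound := (ENNReal.le_ofReal_iff_toReal_le (measure_ne_top _ _) (by positivity)).2
    (sykMeasure_not_mulVec_le n)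
  refine (measure_mono ?_).trans hbound
  intro J hJ hgood
  refine hJ ?_
  have hsos := isSOS_deg42_sykHamiltonian hn hgood
  have hsos3 := hsos.mono (hle n J)
  exact ⟨relaxationValue_le_of_isSOS hsos, relaxationValue_le_of_isSOS hsos3, hsos3⟩
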